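/- Let $X=\{0,1\}$ and let $X^\ast$ be the set of finite words over $X$. The \emph{Basilica group} $B$ is the group of permutations of $X^\ast$ generated by the length-preserving bijections $a,c$ that fix the empty word and satisfy $$a(0w)=0w,\qquad a(1w)=1c(w),\qquad c(0w)=1w,\qquad c(1w)=0a(w)\qquad (w\in X^\ast).$$ It is self-similar: for all $g\in B$ and $x\in X$ there are a unique letter $g(x)\in X$ and a unique element $g|_x\in B$ with $g(xw)=g(x)\,g|_x(w)$ for all $w\in X^\ast$. For a field $K$, the \emph{Nekrashevych algebra} of $B$ over $K$ is the unital $\ast$-algebra over $K$ (with $K$-linear involution) generated by the set $X\cup B$, the identity of $B$ being the identity of the algebra, subject to the relations \begin{itemize} \item $g^\ast=g^{-1}$ and $g\cdot h=gh$ for $g,h\in B$; \item $g\,x=g(x)\,g|_x$ for $g\in B$, $x\in X$; \item $y^\ast x=\delta_{x,y}$ for $x,y\in X$; \item $\sum_{x\in X}xx^\ast=1$. \end{itemize} \textbf{Theorem.} For every field $K$, the Nekrashevych algebra of the Basilica group over $K$ is a simple ring (it is non-zero and has no two-sided ideals other than $0$ and itself). -/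

import Mathlib

universe u v

/-! ## Self-similar groups -/

/-- A group of permutations of the set `X^*` of finite words (that is, a group with a faithful
action on `X^*`) is self-similar if it preserves lengths and for each `g` in it and each letter `x`
there are a letter `g(x)` and an element `g|_x` of the group such that `g(xw) = g(x) g|_x(w)` for
all words `w`. -/
structure IsSelfSimilar {X : Type u} (G : Subgroup (Equiv.Perm (List X))) : Prop where
  length_eq : ∀ g ∈ G, ∀ w : List X, (g w).length = w.length
  exists_section : ∀ g ∈ G, ∀ x : X, ∃ y : X, ∃ h ∈ G, ∀ w : List X, g (x :: w) = y :: h w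

namespace IsSelfSimilar

variable {X : Type u} {G : Subgroup (Equiv.Perm (List X))}

/-- The letter `g(x)`. -/
noncomputable def letter (hG : IsSelfSimilar G) (g : G) (x : X) : X :=
  (hG.exists_section g.1 g.2 x).choose

/-- The section `g|_x`, an element of `G`. -/
noncomputable def sec (hG : IsSelfSimilar G) (g : G) (x : X) : G :=
  ⟨(hG.exists_section g.1 g.2 x).choose_spec.choose,
    (hG.exists_section g.1 g.2 x).choose_spec.choose_spec.1⟩

theorem apply_cons (hG : IsSelfSimilar G) (g : G) (x : X) (w : List X) :
    g.1 (x :: w) = hG.letter g x :: (hG.sec g x).1 w :=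
  (hG.exists_section g.1 g.2 x).choose_spec.choose_spec.2 w

/-- The letter `g(x)` and the section `g|_x` are determined by the defining equation. -/
theorem eq_of_apply_cons (hG : IsSelfSimilar G) {g h : G} {x y : X}
    (H : ∀ w : List X, g.1 (x :: w) = y :: h.1 w) : hG.letter g x = y ∧ hG.sec g x = h := by
  have key : ∀ w, hG.letter g x = y ∧ (hG.sec g x).1 w = h.1 w := fun w => by
    have := (hG.apply_cons g x w).symm.trans (H w)
    exact List.cons_eq_cons.mp this
  exact ⟨(key []).1, Subtype.ext (Equiv.ext fun w => (key w).2)⟩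

end IsSelfSimilar

/-! ## Nekrashevych algebras -/

/-- The free unital `∗`-algebra over `K` on a set `S`: the free algebra on two copies of `S`, where
`Sum.inl s` is the generator `s` and `Sum.inr s` is the formal adjoint `s^∗`. -/
abbrev FreeStarAlg (K : Type v) [CommRing K] (S : Type u) : Type (max u v) :=
  FreeAlgebra K (S ⊕ S)

/-- The involution of the free `∗`-algebra: the `K`-linear anti-automorphism exchanging `s` and
`s^∗` for every `s` in `S`. -/
def FreeStarAlg.adj {K : Type v} [CommRing K] {S : Type u} (p : FreeStarAlg K S) :
    FreeStarAlg K S :=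
  MulOpposite.unop
    (FreeAlgebra.lift K (fun s : S ⊕ S => MulOpposite.op (FreeAlgebra.ι K s.swap)) p)

section Nekrashevych

variable (K : Type v) [CommRing K] {X : Type u} {G : Subgroup (Equiv.Perm (List X))}

/-- The generator `x` for a letter `x`. -/
def nekX (G : Subgroup (Equiv.Perm (List X))) (x : X) : FreeStarAlg K (X ⊕ G) :=
  FreeAlgebra.ι K (Sum.inl (Sum.inl x))

/-- The adjoint `x^∗` of the generator `x`. -/
def nekXAdj (G : Subgroup (Equiv.Perm (List X))) (x : X) : FreeStarAlg K (X ⊕ G) :=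
  FreeAlgebra.ι K (Sum.inr (Sum.inl x))

/-- The generator `g` for an element `g` of the group. -/
def nekG (g : G) : FreeStarAlg K (X ⊕ G) :=
  FreeAlgebra.ι K (Sum.inl (Sum.inr g))

/-- The adjoint `g^∗` of the generator `g`. -/
def nekGAdj (g : G) : FreeStarAlg K (X ⊕ G) :=
  FreeAlgebra.ι K (Sum.inr (Sum.inr g))

/-- The defining relations of the Nekrashevych algebra; the identity of the group is the
identity of the algebra. -/
inductive NekRel [Fintype X] [DecidableEq X] (hG : IsSelfSimilar G) :
    FreeStarAlg K (X ⊕ G) → FreeStarAlg K (X ⊕ G) → Prop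
  | g_adj (g : G) : NekRel hG (nekGAdj K g) (nekG K g⁻¹)
  | g_mul (g h : G) : NekRel hG (nekG K g * nekG K h) (nekG K (g * h))
  | g_one : NekRel hG (nekG K (1 : G)) 1
  | ss (g : G) (x : X) :
      NekRel hG (nekG K g * nekX K G x) (nekX K G (hG.letter g x) * nekG K (hG.sec g x))
  | ck1 (x y : X) : NekRel hG (nekXAdj K G y * nekX K G x) (if x = y then 1 else 0)
  | ck2 : NekRel hG (∑ x : X, nekX K G x * nekXAdj K G x) 1

/-- The relations together with their adjoints. -/
def NekStarRel [Fintype X] [DecidableEq X] (hG : IsSelfSimilar G)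
    (p q : FreeStarAlg K (X ⊕ G)) : Prop :=
  NekRel K hG p q ∨ ∃ p' q', NekRel K hG p' q' ∧ p = p'.adj ∧ q = q'.adj

/-- The Nekrashevych algebra of a self-similar group `G` over the finite alphabet `X` with
coefficients in `K`: the unital `∗`-algebra generated by `X ∪ G` subject to the relations
`NekRel`, that is, the quotient of the free `∗`-algebra by the two-sided ideal generated by
the relations and their adjoints. -/
abbrev NekrashevychAlgebra [Fintype X] [DecidableEq X] (hG : IsSelfSimilar G) :
    Type (max u v) :=
  RingQuot (NekStarRel K hG)

end Nekrashevych

/-! ## The Basilica group -/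

namespace Basilica

mutual
/-- `a(0w) = 0w`, `a(1w) = 1c(w)`. -/
def aFun : List (Fin 2) → List (Fin 2)
  | [] => []
  | 0 :: w => 0 :: w
  | 1 :: w => 1 :: cFun w
/-- `c(0w) = 1w`, `c(1w) = 0a(w)`. -/
def cFun : List (Fin 2) → List (Fin 2)
  | [] => []
  | 0 :: w => 1 :: w
  | 1 :: w => 0 :: aFun w
end

mutual
/-- The inverse of `aFun`. -/
def aInv : List (Fin 2) → List (Fin 2)
  | [] => []
  | 0 :: w => 0 :: w
  | 1 :: w => 1 :: cInv w
/-- The inverse of `cFun`. -/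
def cInv : List (Fin 2) → List (Fin 2)
  | [] => []
  | 1 :: w => 0 :: w
  | 0 :: w => 1 :: aInv w
end

theorem left_inv (w : List (Fin 2)) : aInv (aFun w) = w ∧ cInv (cFun w) = w := by
  induction w with
  | nil => simp [aFun, aInv, cFun, cInv]
  | cons x w ih => fin_cases x <;> simp [aFun, aInv, cFun, cInv, ih.1, ih.2]

theorem right_inv (w : List (Fin 2)) : aFun (aInv w) = w ∧ cFun (cInv w) = w := by
  induction w with
  | nil => simp [aFun, aInv, cFun, cInv]
  | cons x w ih => fin_cases x <;> simp [aFun, aInv, cFun, cInv, ih.1, ih.2]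

theorem length_fun (w : List (Fin 2)) :
    (aFun w).length = w.length ∧ (cFun w).length = w.length := by
  induction w with
  | nil => simp [aFun, cFun]
  | cons x w ih => fin_cases x <;> simp [aFun, cFun, ih.1, ih.2]

/-- The automorphism `a` of the binary tree. -/
def a : Equiv.Perm (List (Fin 2)) where
  toFun := aFun
  invFun := aInv
  left_inv w := (left_inv w).1
  right_inv w := (right_inv w).1

/-- The automorphism `c` of the binary tree. -/
def c : Equiv.Perm (List (Fin 2)) where
  toFun := cFun
  invFun := cInv
  left_inv w := (left_inv w).2
  right_inv w := (right_inv w).2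

/-- The Basilica group, generated by `a` and `c`. -/
def group : Subgroup (Equiv.Perm (List (Fin 2))) := Subgroup.closure {a, c}

theorem isSelfSimilar : IsSelfSimilar group where
  length_eq g hg := by
    induction hg using Subgroup.closure_induction with
    | mem g hg =>
      rcases hg with rfl | rfl
      · exact fun w => (length_fun w).1
      · exact fun w => (length_fun w).2
    | one => exact fun w => rfl
    | mul g h _ _ ihg ihh => exact fun w => (ihg (h w)).trans (ihh w)
    | inv g _ ih =>
      intro w
      have := ih (g⁻¹ w)
      rw [show g (g⁻¹ w) = w from g.apply_symm_apply w] at this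
      exact this.symm
  exists_section g hg := by
    have ha : a ∈ group := Subgroup.subset_closure (by simp)
    have hc : c ∈ group := Subgroup.subset_closure (by simp)
    induction hg using Subgroup.closure_induction'' with
    | mem g hg =>
      rcases hg with rfl | rfl
      · intro x
        fin_cases x
        · exact ⟨0, 1, one_mem _, fun w => by simp [a, aFun]⟩
        · exact ⟨1, c, hc, fun w => by simp [a, c, aFun]⟩
      · intro x
        fin_cases x
        · exact ⟨1, 1, one_mem _, fun w => by simp [c, cFun]⟩
        · exact ⟨0, a, ha, fun w => by simp [a, c, cFun]⟩
    | inv_mem g hg =>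
      rcases hg with rfl | rfl
      · intro x
        fin_cases x
        · exact ⟨0, 1, one_mem _, fun w => by
            rw [Equiv.Perm.inv_eq_iff_eq]; simp [a, aFun]⟩
        · exact ⟨1, c⁻¹, inv_mem hc, fun w => by
            rw [Equiv.Perm.inv_eq_iff_eq]
            change _ = aFun (1 :: c⁻¹ w)
            rw [aFun]
            change _ = 1 :: c (c⁻¹ w)
            rw [show c (c⁻¹ w) = w from c.apply_symm_apply w]; rfl⟩
      · intro x
        fin_cases x
        · exact ⟨1, a⁻¹, inv_mem ha, fun w => by
            rw [Equiv.Perm.inv_eq_iff_eq]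
            change _ = cFun (1 :: a⁻¹ w)
            rw [cFun]
            change _ = 0 :: a (a⁻¹ w)
            rw [show a (a⁻¹ w) = w from a.apply_symm_apply w]; rfl⟩
        · exact ⟨0, 1, one_mem _, fun w => by
            rw [Equiv.Perm.inv_eq_iff_eq]; simp [c, cFun]⟩
    | one => exact fun x => ⟨x, 1, one_mem _, fun w => rfl⟩
    | mul g h _ _ ihg ihh =>
      intro x
      obtain ⟨y, h', hh', H⟩ := ihh x
      obtain ⟨z, g', hg', K⟩ := ihg y
      exact ⟨z, g' * h', mul_mem hg' hh', fun w => by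
        rw [Equiv.Perm.mul_apply, H, K, Equiv.Perm.mul_apply]⟩

end Basilica

/-!
The Nekrashevych algebra `A` of a self-similar group `G` is the matrix algebra over itself indexed
by the words of length `n`, for every `n`; the `(y, u)` entry of `p` is `y^* p u`. Given `p ≠ 0`,
multiplying on the right by a long word makes `p` a combination of monomials `w g`, and multiplying
on the left by the adjoint of a word of the least length occurring gives `q + r` with `0 ≠ q` in the
span of `G` and `r` a combination of monomials `w g` with `w ≠ 1`. If `G` is regular, then for long
words `u` of the same length all the `g` occurring in `q` with `g(u) = y` have the same section at
`u`, so the `(y, u)` entry of `q` is a multiple of a single group element, and we may assume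
`q = 1`. Finally, `t^* r t = 0` for a suitable word `t`, because the letters of a nonempty `w` can
be avoided. Hence `a p b = 1` for some `a` and `b`.

The Basilica group is regular because it is contracting and no element of its nucleus has a
nontrivial section at a word of length two that it fixes. The algebra is nonzero because it acts on
functions on infinite words.
-/

theorem isSimpleRing_of_exists_mul_mul_eq_one {R : Type*} [Ring R] [Nontrivial R]
    (h : ∀ p : R, p ≠ 0 → ∃ a b, a * p * b = 1) : IsSimpleRing R := by
  refine .of_eq_bot_or_eq_top fun I => or_iff_not_imp_left.mpr fun hI => ?_
  obtain ⟨p, hpI, hp⟩ : ∃ p ∈ I, p ≠ 0 := by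
    by_contra! hzero
    exact hI (le_bot_iff.mp fun p hp => (TwoSidedIdeal.mem_bot R).mpr (hzero p hp))
  obtain ⟨a, b, hab⟩ := h p hp
  rw [← TwoSidedIdeal.one_mem_iff, ← hab]
  exact I.mul_mem_right _ _ (I.mul_mem_left _ _ hpI)

theorem exists_eq_append_of_add_le_length {α : Type*} {n k : ℕ} {u : List α}
    (h : n + k ≤ u.length) : ∃ v t, u = v ++ t ∧ n ≤ v.length ∧ t.length = k :=
  ⟨u.take (u.length - k), u.drop (u.length - k), (List.take_append_drop _ u).symm,
    by rw [List.length_take]; omega, by rw [List.length_drop]; omega⟩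

namespace IsSelfSimilar

variable {X : Type u} {G : Subgroup (Equiv.Perm (List X))}

theorem length_apply (hG : IsSelfSimilar G) (g : G) (u : List X) :
    (g.1 u).length = u.length :=
  hG.length_eq g.1 g.2 u

theorem apply_nil (hG : IsSelfSimilar G) (g : G) : g.1 [] = [] :=
  List.length_eq_zero_iff.mp (hG.length_apply g [])

variable (hG : IsSelfSimilar G)

section Sections

theorem letter_sec_mul (g h : G) (x : X) :
    hG.letter (g * h) x = hG.letter g (hG.letter h x) ∧
      hG.sec (g * h) x = hG.sec g (hG.letter h x) * hG.sec h x :=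
  hG.eq_of_apply_cons fun w => by simp [hG.apply_cons]

theorem letter_mul (g h : G) (x : X) : hG.letter (g * h) x = hG.letter g (hG.letter h x) :=
  (hG.letter_sec_mul g h x).1

theorem sec_mul (g h : G) (x : X) :
    hG.sec (g * h) x = hG.sec g (hG.letter h x) * hG.sec h x :=
  (hG.letter_sec_mul g h x).2

@[simp]
theorem letter_sec_one (x : X) : hG.letter 1 x = x ∧ hG.sec 1 x = 1 :=
  hG.eq_of_apply_cons fun _ => rfl

variable {hG} in
theorem letter_sec_inv {g h : G} {x y : X} (H : hG.letter g x = y ∧ hG.sec g x = h) :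
    hG.letter g⁻¹ y = x ∧ hG.sec g⁻¹ y = h⁻¹ :=
  hG.eq_of_apply_cons fun w => Equiv.Perm.inv_eq_iff_eq.mpr <| by
    simp [hG.apply_cons, H]

theorem letter_injective (g : G) : Function.Injective (hG.letter g) :=
  Function.LeftInverse.injective (g := hG.letter g⁻¹) fun _ => (letter_sec_inv ⟨rfl, rfl⟩).1

/-- The section `g|_u` of a group element at a word `u`. -/
noncomputable def secWord (g : G) : List X → G
  | [] => g
  | x :: u => secWord (hG.sec g x) u

@[simp] theorem secWord_nil (g : G) : hG.secWord g [] = g := rfl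

@[simp]
theorem secWord_cons (g : G) (x : X) (u : List X) :
    hG.secWord g (x :: u) = hG.secWord (hG.sec g x) u := rfl

theorem apply_append (g : G) (u w : List X) :
    g.1 (u ++ w) = g.1 u ++ (hG.secWord g u).1 w := by
  induction u generalizing g with
  | nil => simp [hG.apply_nil]
  | cons x u ih => simp [hG.apply_cons, ih]

theorem secWord_append (g : G) (u w : List X) :
    hG.secWord g (u ++ w) = hG.secWord (hG.secWord g u) w := by
  induction u generalizing g with
  | nil => rfl
  | cons x _ ih => exact ih _

theorem secWord_one (u : List X) : hG.secWord 1 u = 1 := by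
  induction u with
  | nil => rfl
  | cons x u ih => simp [ih]

theorem secWord_mul (g h : G) (u : List X) :
    hG.secWord (g * h) u = hG.secWord g (h.1 u) * hG.secWord h u := by
  induction u generalizing g h with
  | nil => simp [hG.apply_nil]
  | cons x u ih => simp [sec_mul, ih, hG.apply_cons]

end Sections

section Regular

/-- A self-similar group is regular if each of its elements has trivial sections at all the
sufficiently long words that it fixes. For a finite alphabet this is Nekrashevych's notion: by
compactness, it says that whenever `g` fixes an infinite word, `g` has a trivial section at one of
the finite prefixes of that word. -/
def IsRegular : Prop :=
  ∀ g : G, ∃ n : ℕ, ∀ u : List X, n ≤ u.length → g.1 u = u → hG.secWord g u = 1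

variable {hG}

theorem IsRegular.exists_secWord_eq (H : hG.IsRegular) (g h : G) :
    ∃ n : ℕ, ∀ u : List X, n ≤ u.length → g.1 u = h.1 u → hG.secWord g u = hG.secWord h u := by
  obtain ⟨n, hn⟩ := H (h⁻¹ * g)
  refine ⟨n, fun u hu hgh => ?_⟩
  have hfix : (h⁻¹ * g).1 u = u := by simp [hgh]
  calc hG.secWord g u = hG.secWord (h * (h⁻¹ * g)) u := by rw [mul_inv_cancel_left]
    _ = hG.secWord h u := by rw [secWord_mul, hn u hu hfix, hfix, mul_one]

theorem IsRegular.exists_forall_mem_secWord_eq (H : hG.IsRegular) (s : Finset G) :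
    ∃ n : ℕ, ∀ u : List X, n ≤ u.length → ∀ g ∈ s, ∀ h ∈ s, g.1 u = h.1 u →
      hG.secWord g u = hG.secWord h u := by
  choose N hN using H.exists_secWord_eq
  refine ⟨(s ×ˢ s).sup fun gh => N gh.1 gh.2, fun u hu g hg h hh => hN g h u (le_trans ?_ hu)⟩
  exact Finset.le_sup (f := fun gh : G × G => N gh.1 gh.2) (Finset.mk_mem_product hg hh)

end Regular

section Contracting

/-- All the sections of each group element at sufficiently long words belong to `N`. The group is
contracting if this holds for a finite set `N`, and the least such set is its nucleus; finiteness
is not part of the definition. -/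
def ContractsInto (N : Set G) : Prop :=
  ∀ g : G, ∃ n : ℕ, ∀ u : List X, n ≤ u.length → hG.secWord g u ∈ N

variable {hG} {S N : Set G} {k : ℕ}

theorem secWord_mem_of_forall_sec_mem (hS : ∀ s ∈ S, ∀ x, hG.sec s x ∈ S) {s : G}
    (hs : s ∈ S) (u : List X) : hG.secWord s u ∈ S := by
  induction u generalizing s with
  | nil => exact hs
  | cons x _ ih => exact ih (hS s hs x)

theorem contractsInto_of_closure_eq_top (hclosure : Subgroup.closure S = ⊤)
    (hinv : ∀ s ∈ S, s⁻¹ ∈ S) (hsec : ∀ s ∈ S, ∀ x, hG.sec s x ∈ S) (hone : 1 ∈ N)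
    (hmul : ∀ s ∈ S, ∀ h ∈ N, ∀ u : List X, u.length = k → hG.secWord (s * h) u ∈ N) :
    hG.ContractsInto N := by
  have mul_left : ∀ s ∈ S, ∀ h : G, (∃ n, ∀ u : List X, n ≤ u.length → hG.secWord h u ∈ N) →
      ∃ n, ∀ u : List X, n ≤ u.length → hG.secWord (s * h) u ∈ N := by
    rintro s hs h ⟨n, hn⟩
    refine ⟨n + k, fun u hu => ?_⟩
    obtain ⟨v, t, rfl, hv, ht⟩ := exists_eq_append_of_add_le_length hu
    rw [secWord_append, secWord_mul]
    exact hmul _ (secWord_mem_of_forall_sec_mem hsec hs _) _ (hn v hv) t ht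
  intro g
  have hg : g ∈ Subgroup.closure S := hclosure ▸ Subgroup.mem_top g
  induction hg using Subgroup.closure_induction_left with
  | one => exact ⟨0, fun u _ => by rwa [secWord_one]⟩
  | mul_left s hs h _ ih => exact mul_left s hs h ih
  | inv_mul_cancel s hs h _ ih => exact mul_left s⁻¹ (hinv s hs) h ih

theorem ContractsInto.isRegular (hN : hG.ContractsInto N)
    (hfix : ∀ h ∈ N, ∀ u : List X, u.length = k → h.1 u = u → hG.secWord h u = 1) :
    hG.IsRegular := by
  intro g
  obtain ⟨n, hn⟩ := hN g
  refine ⟨n + k, fun u hu hgu => ?_⟩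
  obtain ⟨v, t, rfl, hv, ht⟩ := exists_eq_append_of_add_le_length hu
  rw [hG.apply_append] at hgu
  rw [secWord_append]
  exact hfix _ (hn v hv) t ht (List.append_inj_right hgu (hG.length_apply g v))

end Contracting

section Boundary

open Stream'

/-- The image of an infinite word under a group element, computed letter by letter. -/
noncomputable def actStream (g : G) (ω : Stream' X) : Stream' X :=
  corec (fun p : G × Stream' X => hG.letter p.1 p.2.head)
    (fun p => (hG.sec p.1 p.2.head, p.2.tail)) (g, ω)

theorem actStream_cons (g : G) (x : X) (ω : Stream' X) :
    hG.actStream g (x :: ω) = hG.letter g x :: hG.actStream (hG.sec g x) ω :=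
  corec_eq _ _ _

theorem actStream_one (ω : Stream' X) : hG.actStream 1 ω = ω := by
  refine Stream'.ext fun n => ?_
  induction n generalizing ω with
  | zero => rw [← ω.eta, actStream_cons]; simp
  | succ n ih => rw [← ω.eta, actStream_cons, get_succ_cons, get_succ_cons]; simp [ih]

theorem actStream_mul (g h : G) (ω : Stream' X) :
    hG.actStream (g * h) ω = hG.actStream g (hG.actStream h ω) := by
  refine Stream'.ext fun n => ?_
  induction n generalizing g h ω with
  | zero => rw [← ω.eta]; simp only [actStream_cons, get_zero_cons, letter_mul]
  | succ n ih => rw [← ω.eta]; simp only [actStream_cons, get_succ_cons, sec_mul, ih]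

/-- The action of a self-similar group on the boundary of the tree of words, that is, on the set of
infinite words. -/
noncomputable def boundary : G →* Equiv.Perm (Stream' X) :=
  MonoidHom.toHomPerm
    { toFun := hG.actStream
      map_one' := funext hG.actStream_one
      map_mul' := fun g h => funext (hG.actStream_mul g h) }

theorem boundary_cons (g : G) (x : X) (ω : Stream' X) :
    hG.boundary g (x :: ω) = hG.letter g x :: hG.boundary (hG.sec g x) ω :=
  hG.actStream_cons g x ω

end Boundary

end IsSelfSimilar

namespace NekrashevychAlgebra

section CommRing

variable {K : Type v} [CommRing K] {X : Type u} [Fintype X] [DecidableEq X]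
  {G : Subgroup (Equiv.Perm (List X))} {hG : IsSelfSimilar G}

theorem mkAlgHom_eq_of_nekRel {p q : FreeStarAlg K (X ⊕ G)} (h : NekRel K hG p q) :
    RingQuot.mkAlgHom K (NekStarRel K hG) p = RingQuot.mkAlgHom K (NekStarRel K hG) q :=
  RingQuot.mkAlgHom_rel K (Or.inl h)

/-- The letter `x` as an element of the Nekrashevych algebra. -/
def ofX (x : X) : NekrashevychAlgebra K hG := RingQuot.mkAlgHom K _ (nekX K G x)

/-- The adjoint `x^*` of a letter as an element of the Nekrashevych algebra. -/
def ofXAdj (x : X) : NekrashevychAlgebra K hG := RingQuot.mkAlgHom K _ (nekXAdj K G x)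

/-- The group element `g` as an element of the Nekrashevych algebra. -/
def ofG (g : G) : NekrashevychAlgebra K hG := RingQuot.mkAlgHom K _ (nekG K g)

theorem ofG_mul (g h : G) : (ofG (g * h) : NekrashevychAlgebra K hG) = ofG g * ofG h :=
  (mkAlgHom_eq_of_nekRel (.g_mul g h)).symm.trans (map_mul _ _ _)

@[simp]
theorem ofG_one : (ofG 1 : NekrashevychAlgebra K hG) = 1 :=
  (mkAlgHom_eq_of_nekRel .g_one).trans (map_one _)

theorem ofG_mul_ofX (g : G) (x : X) :
    (ofG g * ofX x : NekrashevychAlgebra K hG) = ofX (hG.letter g x) * ofG (hG.sec g x) := by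
  have h := mkAlgHom_eq_of_nekRel (.ss (K := K) (hG := hG) g x)
  rwa [map_mul, map_mul] at h

theorem ofXAdj_mul_ofX (x y : X) :
    (ofXAdj y * ofX x : NekrashevychAlgebra K hG) = if x = y then 1 else 0 := by
  have h := mkAlgHom_eq_of_nekRel (.ck1 (K := K) (hG := hG) x y)
  rwa [map_mul, apply_ite (RingQuot.mkAlgHom K _), map_one, map_zero] at h

theorem sum_ofX_mul_ofXAdj : ∑ x, (ofX x * ofXAdj x : NekrashevychAlgebra K hG) = 1 := by
  have h := mkAlgHom_eq_of_nekRel (.ck2 (K := K) (hG := hG))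
  simp only [map_sum, map_mul, map_one] at h
  exact h

@[elab_as_elim]
theorem induction_on {motive : NekrashevychAlgebra K hG → Prop} (p : NekrashevychAlgebra K hG)
    (algebraMap : ∀ k : K, motive (algebraMap K _ k)) (ofX : ∀ x, motive (ofX x))
    (ofXAdj : ∀ x, motive (ofXAdj x)) (ofG : ∀ g, motive (ofG g))
    (add : ∀ p q, motive p → motive q → motive (p + q))
    (mul : ∀ p q, motive p → motive q → motive (p * q)) : motive p := by
  obtain ⟨p, rfl⟩ := RingQuot.mkAlgHom_surjective K _ p
  induction p using FreeAlgebra.induction with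
  | grade0 k => exact (AlgHom.commutes (RingQuot.mkAlgHom K (NekStarRel K hG)) k) ▸ algebraMap k
  | grade1 s =>
    rcases s with (x | g) | (x | g)
    · exact ofX x
    · exact ofG g
    · exact ofXAdj x
    · exact mkAlgHom_eq_of_nekRel (.g_adj (K := K) (hG := hG) g) ▸ ofG g⁻¹
  | mul p q hp hq => exact map_mul (RingQuot.mkAlgHom K (NekStarRel K hG)) p q ▸ mul _ _ hp hq
  | add p q hp hq => exact map_add (RingQuot.mkAlgHom K (NekStarRel K hG)) p q ▸ add _ _ hp hq

/-- The word `w` as an element of the Nekrashevych algebra: the product of its letters. -/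
def ofWord (w : List X) : NekrashevychAlgebra K hG := (w.map ofX).prod

/-- The adjoint `w^*` of a word: the product of the adjoints of its letters in reverse order. -/
def ofWordAdj (w : List X) : NekrashevychAlgebra K hG := (w.reverse.map ofXAdj).prod

@[simp]
theorem ofWord_nil : (ofWord [] : NekrashevychAlgebra K hG) = 1 := rfl

@[simp]
theorem ofWordAdj_nil : (ofWordAdj [] : NekrashevychAlgebra K hG) = 1 := rfl

theorem ofWord_cons (x : X) (w : List X) :
    (ofWord (x :: w) : NekrashevychAlgebra K hG) = ofX x * ofWord w := by
  simp [ofWord]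

theorem ofWordAdj_cons (x : X) (w : List X) :
    (ofWordAdj (x :: w) : NekrashevychAlgebra K hG) = ofWordAdj w * ofXAdj x := by
  simp [ofWordAdj]

theorem ofWord_append (u w : List X) :
    (ofWord (u ++ w) : NekrashevychAlgebra K hG) = ofWord u * ofWord w := by
  simp [ofWord]

theorem ofWordAdj_append (u w : List X) :
    (ofWordAdj (u ++ w) : NekrashevychAlgebra K hG) = ofWordAdj w * ofWordAdj u := by
  simp [ofWordAdj]

theorem ofG_mul_ofWord (g : G) (w : List X) :
    (ofG g * ofWord w : NekrashevychAlgebra K hG) = ofWord (g.1 w) * ofG (hG.secWord g w) := by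
  induction w generalizing g with
  | nil => simp [hG.apply_nil]
  | cons x w ih =>
    rw [ofWord_cons, ← mul_assoc, ofG_mul_ofX, mul_assoc, ih, ← mul_assoc, ← ofWord_cons,
      hG.apply_cons, hG.secWord_cons]

theorem ofWordAdj_cons_mul_ofWord_cons (x y : X) (u w : List X) :
    (ofWordAdj (y :: u) * ofWord (x :: w) : NekrashevychAlgebra K hG) =
      if x = y then ofWordAdj u * ofWord w else 0 := by
  rw [ofWordAdj_cons, ofWord_cons, mul_assoc, ← mul_assoc (ofXAdj y), ofXAdj_mul_ofX]
  split_ifs <;> simp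

theorem ofWordAdj_mul_ofWord_append (u w : List X) :
    (ofWordAdj u * ofWord (u ++ w) : NekrashevychAlgebra K hG) = ofWord w := by
  induction u with
  | nil => simp
  | cons x u ih => rw [List.cons_append, ofWordAdj_cons_mul_ofWord_cons, if_pos rfl, ih]

theorem ofWordAdj_mul_ofWord_eq_zero {u w : List X} (hlen : u.length ≤ w.length)
    (hpre : ¬ u <+: w) : (ofWordAdj u * ofWord w : NekrashevychAlgebra K hG) = 0 := by
  induction u generalizing w with
  | nil => exact absurd List.nil_prefix hpre
  | cons y u ih =>
    cases w with
    | nil => simp at hlen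
    | cons x w =>
      rw [ofWordAdj_cons_mul_ofWord_cons, ite_eq_right_iff]
      rintro rfl
      exact ih (Nat.le_of_succ_le_succ hlen) fun h => hpre (List.prefix_cons_inj x |>.mpr h)

theorem ofWordAdj_mul_ofWord_of_length_eq {u w : List X} (hlen : u.length = w.length) :
    (ofWordAdj u * ofWord w : NekrashevychAlgebra K hG) = if u = w then 1 else 0 := by
  split_ifs with h
  · simpa [h] using ofWordAdj_mul_ofWord_append (K := K) (hG := hG) w []
  · exact ofWordAdj_mul_ofWord_eq_zero hlen.le fun hpre => h (hpre.eq_of_length hlen)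

theorem exists_mul_ofWord_ne_zero (n : ℕ) {p : NekrashevychAlgebra K hG} (hp : p ≠ 0) :
    ∃ u : List X, u.length = n ∧ p * ofWord u ≠ 0 := by
  induction n generalizing p with
  | zero => exact ⟨[], rfl, by simpa using hp⟩
  | succ n ih =>
    obtain ⟨x, hx⟩ : ∃ x : X, p * ofX x ≠ 0 := by
      by_contra! h
      refine hp ?_
      rw [← mul_one p, ← sum_ofX_mul_ofXAdj, Finset.mul_sum]
      exact Finset.sum_eq_zero fun x _ => by rw [← mul_assoc, h, zero_mul]
    obtain ⟨u, rfl, hu⟩ := ih hx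
    exact ⟨x :: u, rfl, by rwa [ofWord_cons, ← mul_assoc]⟩

theorem exists_ofWordAdj_mul_ne_zero (n : ℕ) {p : NekrashevychAlgebra K hG} (hp : p ≠ 0) :
    ∃ y : List X, y.length = n ∧ ofWordAdj y * p ≠ 0 := by
  induction n generalizing p with
  | zero => exact ⟨[], rfl, by simpa using hp⟩
  | succ n ih =>
    obtain ⟨x, hx⟩ : ∃ x : X, ofXAdj x * p ≠ 0 := by
      by_contra! h
      refine hp ?_
      rw [← one_mul p, ← sum_ofX_mul_ofXAdj, Finset.sum_mul]
      exact Finset.sum_eq_zero fun x _ => by rw [mul_assoc, h, mul_zero]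
    obtain ⟨y, rfl, hy⟩ := ih hx
    exact ⟨x :: y, rfl, by rwa [ofWordAdj_cons, mul_assoc]⟩

/-- The element `w g` of the Nekrashevych algebra, for a word `w` and a group element `g`. -/
def monomial (w : List X) (g : G) : NekrashevychAlgebra K hG := ofWord w * ofG g

theorem ofX_mul_monomial (x : X) (w : List X) (g : G) :
    (ofX x * monomial w g : NekrashevychAlgebra K hG) = monomial (x :: w) g := by
  rw [monomial, monomial, ofWord_cons, mul_assoc]

theorem ofG_mul_monomial (h : G) (w : List X) (g : G) :
    (ofG h * monomial w g : NekrashevychAlgebra K hG) =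
      monomial (h.1 w) (hG.secWord h w * g) := by
  rw [monomial, monomial, ofG_mul, ← mul_assoc, ← mul_assoc, ofG_mul_ofWord]

theorem monomial_mul_ofWord (w : List X) (g : G) (u : List X) :
    (monomial w g * ofWord u : NekrashevychAlgebra K hG) =
      monomial (w ++ g.1 u) (hG.secWord g u) := by
  rw [monomial, monomial, ofWord_append, mul_assoc, mul_assoc, ofG_mul_ofWord]

theorem ofWordAdj_mul_monomial_append (y w : List X) (g : G) :
    (ofWordAdj y * monomial (y ++ w) g : NekrashevychAlgebra K hG) = monomial w g := by
  rw [monomial, monomial, ← mul_assoc, ofWordAdj_mul_ofWord_append]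

theorem ofWordAdj_mul_monomial_eq_zero {y w : List X} (hlen : y.length ≤ w.length)
    (hpre : ¬ y <+: w) (g : G) :
    (ofWordAdj y * monomial w g : NekrashevychAlgebra K hG) = 0 := by
  rw [monomial, ← mul_assoc, ofWordAdj_mul_ofWord_eq_zero hlen hpre, zero_mul]

section MonomialSpan

variable (K hG) in
/-- The span of the monomials `w g` such that the length of `w` belongs to `s`. -/
def monomialSpan (s : Set ℕ) : Submodule K (NekrashevychAlgebra K hG) :=
  .span K ((fun p : List X × G => monomial p.1 p.2) '' {p | p.1.length ∈ s})

variable {s t : Set ℕ} {p : NekrashevychAlgebra K hG}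

theorem monomial_mem_monomialSpan {w : List X} (hw : w.length ∈ s) (g : G) :
    monomial w g ∈ monomialSpan K hG s :=
  Submodule.subset_span ⟨(w, g), hw, rfl⟩

theorem monomialSpan_le {S : Submodule K (NekrashevychAlgebra K hG)} :
    monomialSpan K hG s ≤ S ↔ ∀ w : List X, w.length ∈ s → ∀ g : G, monomial w g ∈ S := by
  rw [monomialSpan, Submodule.span_le, Set.image_subset_iff]
  exact ⟨fun h w hw g => h (a := (w, g)) hw, fun h p hp => h p.1 hp p.2⟩

theorem monomialSpan_mono (h : s ⊆ t) : monomialSpan K hG s ≤ monomialSpan K hG t :=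
  monomialSpan_le.mpr fun _ hw _ => monomial_mem_monomialSpan (h hw) _

theorem monomialSpan_union :
    monomialSpan K hG (s ∪ t) = monomialSpan K hG s ⊔ monomialSpan K hG t := by
  rw [monomialSpan, monomialSpan, monomialSpan, ← Submodule.span_union, ← Set.image_union]
  rfl

theorem monomialSpan_singleton_zero :
    monomialSpan K hG {0} = Submodule.span K (Set.range ofG) := by
  refine congrArg (Submodule.span K) (Set.ext fun p => ?_)
  simp [monomial, List.length_eq_zero_iff]

theorem map_mem_of_mem_monomialSpan {S : Submodule K (NekrashevychAlgebra K hG)}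
    (f : NekrashevychAlgebra K hG →ₗ[K] NekrashevychAlgebra K hG)
    (hf : ∀ w : List X, w.length ∈ s → ∀ g : G, f (monomial w g) ∈ S)
    (hp : p ∈ monomialSpan K hG s) : f p ∈ S :=
  have h : monomialSpan K hG s ≤ S.comap f := monomialSpan_le.mpr hf
  h hp

theorem ofX_mul_mem_monomialSpan (x : X) (hp : p ∈ monomialSpan K hG s) :
    ofX x * p ∈ monomialSpan K hG ((· + 1) '' s) := by
  refine map_mem_of_mem_monomialSpan (LinearMap.mulLeft K (ofX x)) (fun w hw g => ?_) hp
  rw [LinearMap.mulLeft_apply, ofX_mul_monomial]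
  refine monomial_mem_monomialSpan ?_ g
  exact Set.mem_image_of_mem (· + 1) hw

theorem ofG_mul_mem_monomialSpan (h : G) (hp : p ∈ monomialSpan K hG s) :
    ofG h * p ∈ monomialSpan K hG s := by
  refine map_mem_of_mem_monomialSpan (LinearMap.mulLeft K (ofG h)) (fun w hw g => ?_) hp
  rw [LinearMap.mulLeft_apply, ofG_mul_monomial]
  exact monomial_mem_monomialSpan (by rwa [hG.length_apply]) _

theorem mul_ofWord_mem_monomialSpan (u : List X) (hp : p ∈ monomialSpan K hG s) :
    p * ofWord u ∈ monomialSpan K hG ((u.length + ·) '' s) := by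
  refine map_mem_of_mem_monomialSpan (LinearMap.mulRight K (ofWord u)) (fun w hw g => ?_) hp
  rw [LinearMap.mulRight_apply, monomial_mul_ofWord]
  refine monomial_mem_monomialSpan ?_ _
  rw [List.length_append, hG.length_apply, add_comm]
  exact Set.mem_image_of_mem (u.length + ·) hw

theorem ofWordAdj_mul_mem_monomialSpan {y : List X}
    (hp : p ∈ monomialSpan K hG ((y.length + ·) '' s)) :
    ofWordAdj y * p ∈ monomialSpan K hG s := by
  refine map_mem_of_mem_monomialSpan (LinearMap.mulLeft K (ofWordAdj y)) (fun w hw g => ?_) hp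
  obtain ⟨k, hk, hw : y.length + k = w.length⟩ := hw
  rw [LinearMap.mulLeft_apply]
  by_cases hpre : y <+: w
  · obtain ⟨z, rfl⟩ := hpre
    rw [List.length_append, Nat.add_left_cancel_iff] at hw
    rw [ofWordAdj_mul_monomial_append]
    exact monomial_mem_monomialSpan (hw ▸ hk) g
  · rw [ofWordAdj_mul_monomial_eq_zero (by lia) hpre]
    exact zero_mem _

open Set in
theorem exists_forall_mul_mem_monomialSpan_Ici (p : NekrashevychAlgebra K hG) :
    ∃ n : ℕ, ∀ m : ℕ, ∀ q ∈ monomialSpan K hG (Ici (n + m)), p * q ∈ monomialSpan K hG (Ici m) := by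
  induction p using induction_on with
  | algebraMap k =>
    refine ⟨0, fun m q hq => ?_⟩
    rw [← Algebra.smul_def]
    exact Submodule.smul_mem _ k (by rwa [zero_add] at hq)
  | ofX x =>
    refine ⟨0, fun m q hq => monomialSpan_mono ?_ (ofX_mul_mem_monomialSpan x hq)⟩
    rintro _ ⟨k, hk : 0 + m ≤ k, rfl⟩
    exact Set.mem_Ici.mpr (by lia)
  | ofXAdj x =>
    refine ⟨1, fun m q hq => ?_⟩
    have h := ofWordAdj_mul_mem_monomialSpan (y := [x]) (s := Ici m) (p := q)
    rw [List.length_singleton, image_const_add_Ici] at h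
    simpa [ofWordAdj_cons] using h hq
  | ofG g => exact ⟨0, fun m q hq => ofG_mul_mem_monomialSpan g (by rwa [zero_add] at hq)⟩
  | add p₁ p₂ h₁ h₂ =>
    obtain ⟨n₁, h₁⟩ := h₁
    obtain ⟨n₂, h₂⟩ := h₂
    refine ⟨max n₁ n₂, fun m q hq => ?_⟩
    rw [add_mul]
    exact add_mem (h₁ m q (monomialSpan_mono (Ici_subset_Ici.mpr (by lia)) hq))
      (h₂ m q (monomialSpan_mono (Ici_subset_Ici.mpr (by lia)) hq))
  | mul p₁ p₂ h₁ h₂ =>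
    obtain ⟨n₁, h₁⟩ := h₁
    obtain ⟨n₂, h₂⟩ := h₂
    refine ⟨n₂ + n₁, fun m q hq => ?_⟩
    rw [mul_assoc]
    exact h₁ m _ (h₂ (n₁ + m) q (by rwa [← add_assoc]))

theorem exists_mul_ofWord_mem_monomialSpan (hp : p ≠ 0) :
    ∃ u : List X, p * ofWord u ≠ 0 ∧ p * ofWord u ∈ monomialSpan K hG Set.univ := by
  obtain ⟨n, hn⟩ := exists_forall_mul_mem_monomialSpan_Ici p
  obtain ⟨u, rfl, hu⟩ := exists_mul_ofWord_ne_zero n hp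
  have ofWord_mem : ofWord u ∈ monomialSpan K hG (Set.Ici (u.length + 0)) := by
    simpa [monomial] using monomial_mem_monomialSpan (K := K) (hG := hG) (Set.self_mem_Ici) 1
  exact ⟨u, hu, monomialSpan_mono (Set.subset_univ _) (hn 0 _ ofWord_mem)⟩

theorem exists_finset_mem_monomialSpan (hp : p ∈ monomialSpan K hG s) :
    ∃ F : Finset ℕ, p ∈ monomialSpan K hG F := by
  obtain ⟨T, -, c, rfl⟩ := (Submodule.mem_span_image_iff_exists_fun K).mp hp
  refine ⟨T.image fun x => x.1.length, sum_mem fun x _ => Submodule.smul_mem _ _ ?_⟩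
  exact monomial_mem_monomialSpan (Finset.mem_image_of_mem (fun x => x.1.length) x.2) _

open Set in
theorem exists_eq_add_of_mem_monomialSpan (hp : p ∈ monomialSpan K hG s) (hp0 : p ≠ 0) :
    ∃ d : ℕ, ∃ q ∈ monomialSpan K hG {d}, ∃ r ∈ monomialSpan K hG (Ioi d), q ≠ 0 ∧ p = q + r := by
  obtain ⟨F, hF⟩ := exists_finset_mem_monomialSpan hp
  clear hp
  induction F using Finset.induction_on_min generalizing p with
  | empty => exact absurd (by simpa [monomialSpan] using hF) hp0
  | insert d F hd ih =>
    rw [Finset.coe_insert, Set.insert_eq, monomialSpan_union, Submodule.mem_sup] at hF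
    obtain ⟨q, hq, r, hr, rfl⟩ := hF
    by_cases hq0 : q = 0
    · subst hq0
      simpa using ih (by simpa using hp0) hr
    · exact ⟨d, q, hq, r, monomialSpan_mono hd hr, hq0, rfl⟩

end MonomialSpan

/-- The map `p ↦ y^* p u`. When `y` and `u` range over the words of length `n`, the values of these
maps at `p` are the entries of the matrix of `p` under the isomorphism of the Nekrashevych algebra
with the matrices over itself indexed by the words of length `n`. -/
def entry (y u : List X) : NekrashevychAlgebra K hG →ₗ[K] NekrashevychAlgebra K hG :=
  LinearMap.mulLeftRight K (ofWordAdj y, ofWord u)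

theorem entry_apply (y u : List X) (p : NekrashevychAlgebra K hG) :
    entry y u p = ofWordAdj y * p * ofWord u := rfl

theorem entry_append (y z u v : List X) (p : NekrashevychAlgebra K hG) :
    entry (y ++ z) (u ++ v) p = entry z v (entry y u p) := by
  simp only [entry_apply, ofWordAdj_append, ofWord_append, mul_assoc]

theorem entry_ofG {y u : List X} (hlen : y.length = u.length) (g : G) :
    entry y u (ofG g : NekrashevychAlgebra K hG) =
      if y = g.1 u then ofG (hG.secWord g u) else 0 := by
  rw [entry_apply, mul_assoc, ofG_mul_ofWord, ← mul_assoc,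
    ofWordAdj_mul_ofWord_of_length_eq (hlen.trans (hG.length_apply g u).symm), ite_mul, one_mul,
    zero_mul]

theorem entry_self_one (u : List X) : entry u u (1 : NekrashevychAlgebra K hG) = 1 := by
  rw [entry_apply, mul_one, ofWordAdj_mul_ofWord_of_length_eq rfl, if_pos rfl]

theorem entry_mem_monomialSpan {y u : List X} (hlen : y.length = u.length) {s : Set ℕ}
    {p : NekrashevychAlgebra K hG} (hp : p ∈ monomialSpan K hG s) :
    entry y u p ∈ monomialSpan K hG s := by
  rw [entry_apply, mul_assoc]
  exact ofWordAdj_mul_mem_monomialSpan (hlen ▸ mul_ofWord_mem_monomialSpan u hp)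

theorem exists_entry_ne_zero (n : ℕ) {p : NekrashevychAlgebra K hG} (hp : p ≠ 0) :
    ∃ y u : List X, y.length = n ∧ u.length = n ∧ entry y u p ≠ 0 := by
  obtain ⟨y, hy, hyp⟩ := exists_ofWordAdj_mul_ne_zero n hp
  obtain ⟨u, hu, hyu⟩ := exists_mul_ofWord_ne_zero n hyp
  exact ⟨y, u, hy, hu, hyu⟩

theorem exists_entry_eq_smul_ofG (H : hG.IsRegular) {q : NekrashevychAlgebra K hG}
    (hq : q ∈ Submodule.span K (Set.range ofG)) (hq0 : q ≠ 0) :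
    ∃ y u : List X, y.length = u.length ∧
      ∃ k : K, k ≠ 0 ∧ ∃ h : G, entry y u q = k • ofG h := by
  obtain ⟨f, rfl⟩ := Finsupp.mem_span_range_iff_exists_finsupp.mp hq
  obtain ⟨n, hn⟩ := H.exists_forall_mem_secWord_eq f.support
  obtain ⟨y, u, rfl, hu, hyu⟩ := exists_entry_ne_zero n hq0
  obtain ⟨h, hh⟩ : ∃ h, ∀ g ∈ f.support, y = g.1 u → hG.secWord g u = h := by
    by_cases hex : ∃ h ∈ f.support, y = h.1 u
    · obtain ⟨h, hh, hyh⟩ := hex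
      exact ⟨hG.secWord h u, fun g hg hyg => hn u hu.ge g hg h hh (hyg.symm.trans hyh)⟩
    · exact ⟨1, fun g hg hyg => absurd ⟨g, hg, hyg⟩ hex⟩
  have mem_span : entry y u (f.sum fun g k => k • ofG g) ∈
      Submodule.span K {(ofG h : NekrashevychAlgebra K hG)} := by
    rw [Finsupp.sum, map_sum]
    refine sum_mem fun g hg => ?_
    rw [map_smul, entry_ofG hu.symm]
    refine Submodule.smul_mem _ _ ?_
    split_ifs with hyg
    · exact hh g hg hyg ▸ Submodule.mem_span_singleton_self _
    · exact zero_mem _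
  obtain ⟨k, hk⟩ := Submodule.mem_span_singleton.mp mem_span
  exact ⟨y, u, hu.symm, k, fun hk0 => hyu (by rw [← hk, hk0, zero_smul]), h, hk.symm⟩

theorem exists_entry_append_singleton_monomial_eq_zero [Nontrivial X] {w : List X}
    (hw : 0 < w.length) (g : G) (u : List X) :
    ∃ y : X, entry (u ++ [y]) (u ++ [y]) (monomial w g : NekrashevychAlgebra K hG) = 0 := by
  have hlt : u.length < (w ++ g.1 u).length := by
    rw [List.length_append, hG.length_apply]
    omega
  obtain ⟨y, hy⟩ := exists_ne (w ++ g.1 u)[u.length]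
  refine ⟨y, ?_⟩
  rw [entry_apply, mul_assoc, monomial_mul_ofWord]
  refine ofWordAdj_mul_monomial_eq_zero (by simp [hG.length_apply]) (fun hpre => hy ?_) _
  rw [hG.apply_append, ← List.append_assoc] at hpre
  have := hpre.getElem (i := u.length) (by simp)
  rwa [List.getElem_append_left hlt, List.getElem_concat_length rfl] at this

theorem exists_entry_self_eq_zero [Nontrivial X] {r : NekrashevychAlgebra K hG}
    (hr : r ∈ monomialSpan K hG (Set.Ioi 0)) : ∃ t : List X, entry t t r = 0 := by
  suffices ∀ u : List X, ∃ v, entry (u ++ v) (u ++ v) r = 0 from (this []).imp fun _ h => h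
  induction hr using Submodule.span_induction with
  | mem r hr =>
    obtain ⟨⟨w, g⟩, hw, rfl⟩ := hr
    intro u
    obtain ⟨y, hy⟩ :=
      exists_entry_append_singleton_monomial_eq_zero (K := K) (hG := hG) hw g u
    exact ⟨[y], hy⟩
  | zero => exact fun u => ⟨[], map_zero _⟩
  | add p q _ _ hp hq =>
    intro u
    obtain ⟨v, hv⟩ := hp u
    obtain ⟨w, hw⟩ := hq (u ++ v)
    refine ⟨v ++ w, ?_⟩
    rw [← List.append_assoc, map_add, hw, entry_append, hv, map_zero, add_zero]
  | smul k p _ hp => exact fun u => (hp u).imp fun v hv => by rw [map_smul, hv, smul_zero]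

theorem exists_mul_mul_eq_add {p : NekrashevychAlgebra K hG} (hp : p ≠ 0) :
    ∃ a b : NekrashevychAlgebra K hG, ∃ q ∈ Submodule.span K (Set.range ofG),
      ∃ r ∈ monomialSpan K hG (Set.Ioi 0), q ≠ 0 ∧ a * p * b = q + r := by
  obtain ⟨u, hu, hmem⟩ := exists_mul_ofWord_mem_monomialSpan hp
  obtain ⟨d, q, hq, r, hr, hq0, hqr⟩ := exists_eq_add_of_mem_monomialSpan hmem hu
  obtain ⟨y, rfl, hy⟩ := exists_ofWordAdj_mul_ne_zero d hq0
  refine ⟨ofWordAdj y, ofWord u, ofWordAdj y * q, ?_, ofWordAdj y * r, ?_, hy, ?_⟩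
  · rw [← monomialSpan_singleton_zero]
    exact ofWordAdj_mul_mem_monomialSpan (by simpa using hq)
  · exact ofWordAdj_mul_mem_monomialSpan (by simpa using hr)
  · rw [mul_assoc, hqr, mul_add]

end CommRing

section Field

variable {K : Type v} [Field K] {X : Type u} [Fintype X] [DecidableEq X]
  {G : Subgroup (Equiv.Perm (List X))} {hG : IsSelfSimilar G}

theorem exists_mul_mul_eq_one_add (H : hG.IsRegular) {p : NekrashevychAlgebra K hG} (hp : p ≠ 0) :
    ∃ a b : NekrashevychAlgebra K hG, ∃ r ∈ monomialSpan K hG (Set.Ioi 0), a * p * b = 1 + r := by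
  obtain ⟨a, b, q, hq, r, hr, hq0, hab⟩ := exists_mul_mul_eq_add hp
  obtain ⟨y, u, hyu, k, hk, h, hkh⟩ := exists_entry_eq_smul_ofG H hq hq0
  refine ⟨k⁻¹ • ofG h⁻¹ * ofWordAdj y * a, b * ofWord u, k⁻¹ • ofG h⁻¹ * entry y u r, ?_, ?_⟩
  · rw [smul_mul_assoc]
    exact Submodule.smul_mem _ _ (ofG_mul_mem_monomialSpan _ (entry_mem_monomialSpan hyu hr))
  calc k⁻¹ • ofG h⁻¹ * ofWordAdj y * a * p * (b * ofWord u)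
      = k⁻¹ • ofG h⁻¹ * entry y u (a * p * b) := by simp only [entry_apply, mul_assoc]
    _ = k⁻¹ • ofG h⁻¹ * k • ofG h + k⁻¹ • ofG h⁻¹ * entry y u r := by
      rw [hab, map_add, hkh, mul_add]
    _ = 1 + k⁻¹ • ofG h⁻¹ * entry y u r := by
      rw [smul_mul_smul_comm, inv_mul_cancel₀ hk, ← ofG_mul, inv_mul_cancel, ofG_one, one_smul]

theorem exists_mul_mul_eq_one [Nontrivial X] (H : hG.IsRegular) {p : NekrashevychAlgebra K hG}
    (hp : p ≠ 0) : ∃ a b : NekrashevychAlgebra K hG, a * p * b = 1 := by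
  obtain ⟨a, b, r, hr, hab⟩ := exists_mul_mul_eq_one_add H hp
  obtain ⟨t, ht⟩ := exists_entry_self_eq_zero hr
  refine ⟨ofWordAdj t * a, b * ofWord t, ?_⟩
  calc ofWordAdj t * a * p * (b * ofWord t)
      = entry t t (a * p * b) := by simp only [entry_apply, mul_assoc]
    _ = 1 := by rw [hab, map_add, entry_self_one, ht, add_zero]

end Field

end NekrashevychAlgebra

namespace FreeStarAlg

variable {K : Type v} [CommRing K] {S : Type u}

theorem adj_ι (s : S ⊕ S) : adj (FreeAlgebra.ι K s) = FreeAlgebra.ι K s.swap := by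
  simp [adj]

theorem adj_one : (1 : FreeStarAlg K S).adj = 1 := by
  simp [adj]

theorem adj_zero : (0 : FreeStarAlg K S).adj = 0 := by
  simp [adj]

theorem adj_mul (p q : FreeStarAlg K S) : (p * q).adj = q.adj * p.adj := by
  simp [adj]

theorem adj_sum {ι : Type*} (s : Finset ι) (f : ι → FreeStarAlg K S) :
    (∑ i ∈ s, f i).adj = ∑ i ∈ s, (f i).adj := by
  simp [adj]

variable {X : Type u} {G : Subgroup (Equiv.Perm (List X))}

theorem adj_nekX (x : X) : (nekX K G x).adj = nekXAdj K G x := adj_ι _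

theorem adj_nekXAdj (x : X) : (nekXAdj K G x).adj = nekX K G x := adj_ι _

theorem adj_nekG (g : G) : (nekG K g).adj = nekGAdj K g := adj_ι _

theorem adj_nekGAdj (g : G) : (nekGAdj K g).adj = nekG K g := adj_ι _

end FreeStarAlg

namespace NekrashevychAlgebra

section Representation

open Stream'

variable {K : Type v} [CommRing K] {X : Type u} [DecidableEq X]
  {G : Subgroup (Equiv.Perm (List X))} (hG : IsSelfSimilar G)

variable (K) in
/-- The action of the free `∗`-algebra on functions on infinite words by transport of functions: `x`
is extension by zero along `ω ↦ x ω`, `x^*` is restriction along it, and `g` is composition with the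
inverse of `g`. It satisfies the relations of the Nekrashevych algebra. -/
noncomputable def rep : FreeStarAlg K (X ⊕ G) →ₐ[K] Module.End K (Stream' X → K) :=
  FreeAlgebra.lift K fun
    | .inl (.inl x) => .pi fun ω => if ω.head = x then .proj ω.tail else 0
    | .inl (.inr g) => .funLeft K K (hG.boundary g⁻¹)
    | .inr (.inl x) => .funLeft K K (cons x)
    | .inr (.inr g) => .funLeft K K (hG.boundary g)

theorem rep_nekX (x : X) (f : Stream' X → K) (ω : Stream' X) :
    rep K hG (nekX K G x) f ω = if ω.head = x then f ω.tail else 0 := by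
  rw [rep, nekX, FreeAlgebra.lift_ι_apply, LinearMap.pi_apply]
  split_ifs <;> rfl

theorem rep_nekXAdj (x : X) (f : Stream' X → K) (ω : Stream' X) :
    rep K hG (nekXAdj K G x) f ω = f (x :: ω) := by
  rw [rep, nekXAdj, FreeAlgebra.lift_ι_apply]
  rfl

theorem rep_nekG (g : G) (f : Stream' X → K) (ω : Stream' X) :
    rep K hG (nekG K g) f ω = f (hG.boundary g⁻¹ ω) := by
  rw [rep, nekG, FreeAlgebra.lift_ι_apply]
  rfl

theorem rep_nekGAdj (g : G) (f : Stream' X → K) (ω : Stream' X) :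
    rep K hG (nekGAdj K g) f ω = f (hG.boundary g ω) := by
  rw [rep, nekGAdj, FreeAlgebra.lift_ι_apply]
  rfl

theorem rep_nekG_mul_nekX (g : G) (x : X) :
    rep K hG (nekG K g * nekX K G x) =
      rep K hG (nekX K G (hG.letter g x) * nekG K (hG.sec g x)) := by
  refine LinearMap.ext fun f => funext fun ω => ?_
  obtain ⟨η, rfl⟩ := (hG.boundary g).surjective ω
  obtain ⟨y, η, rfl⟩ : ∃ y ζ, η = cons y ζ := ⟨_, _, (Stream'.eta η).symm⟩
  have boundary_inv : hG.boundary g⁻¹ (hG.boundary g (y :: η)) = y :: η := by simp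
  rw [map_mul, map_mul, Module.End.mul_apply, Module.End.mul_apply, rep_nekG, boundary_inv,
    hG.boundary_cons]
  by_cases hyx : y = x <;> simp [rep_nekX, rep_nekG, (hG.letter_injective g).eq_iff, hyx]

theorem rep_nekXAdj_mul_nekX (x y : X) :
    rep K hG (nekXAdj K G y * nekX K G x) = rep K hG (if x = y then 1 else 0) := by
  refine LinearMap.ext fun f => funext fun ω => ?_
  split_ifs with h <;> simp [rep_nekX, rep_nekXAdj, h, Ne.symm]

theorem rep_sum_nekX_mul_nekXAdj [Fintype X] :
    rep K hG (∑ x : X, nekX K G x * nekXAdj K G x) = rep K hG 1 := by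
  refine LinearMap.ext fun f => funext fun ω => ?_
  simp [rep_nekX, rep_nekXAdj, Stream'.eta]

theorem rep_eq_of_nekRel [Fintype X] {p q : FreeStarAlg K (X ⊕ G)} (h : NekRel K hG p q) :
    rep K hG p = rep K hG q := by
  cases h with
  | g_adj g => ext f ω; rw [rep_nekGAdj, rep_nekG, inv_inv]
  | g_mul g h => ext f ω; simp [rep_nekG]
  | g_one => ext f ω; simp [rep_nekG]
  | ss g x => exact rep_nekG_mul_nekX hG g x
  | ck1 x y => exact rep_nekXAdj_mul_nekX hG x y
  | ck2 => exact rep_sum_nekX_mul_nekXAdj hG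

open FreeStarAlg in
theorem rep_adj_eq_of_nekRel [Fintype X] {p q : FreeStarAlg K (X ⊕ G)} (h : NekRel K hG p q) :
    rep K hG p.adj = rep K hG q.adj := by
  cases h with
  | g_adj g => ext f ω; rw [adj_nekGAdj, adj_nekG, rep_nekG, rep_nekGAdj]
  | g_mul g h => ext f ω; simp [adj_mul, adj_nekG, rep_nekGAdj]
  | g_one => ext f ω; simp [adj_one, adj_nekG, rep_nekGAdj]
  | ss g x =>
    ext f ω
    simp [adj_mul, adj_nekG, adj_nekX, rep_nekGAdj, rep_nekXAdj, hG.boundary_cons]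
  | ck1 x y =>
    rw [adj_mul, adj_nekX, adj_nekXAdj, rep_nekXAdj_mul_nekX, apply_ite adj, adj_one, adj_zero]
    simp only [eq_comm]
  | ck2 =>
    simp only [adj_sum, adj_mul, adj_nekX, adj_nekXAdj, adj_one]
    exact rep_sum_nekX_mul_nekXAdj hG

theorem nontrivial [Fintype X] [Nontrivial K] [Nonempty X] :
    Nontrivial (NekrashevychAlgebra K hG) := by
  have rep_eq {p q} : NekStarRel K hG p q → rep K hG p = rep K hG q := by
    rintro (h | ⟨p, q, h, rfl, rfl⟩)
    · exact rep_eq_of_nekRel hG h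
    · exact rep_adj_eq_of_nekRel hG h
  have : Nonempty (Stream' X) := ‹Nonempty X›.map const
  exact (RingQuot.liftAlgHom K ⟨rep K hG, fun _ _ h => rep_eq h⟩).toRingHom.domain_nontrivial

end Representation

theorem isSimpleRing_of_isRegular {K : Type v} [Field K] {X : Type u} [Fintype X] [DecidableEq X]
    [Nontrivial X] {G : Subgroup (Equiv.Perm (List X))} {hG : IsSelfSimilar G}
    (H : hG.IsRegular) : IsSimpleRing (NekrashevychAlgebra K hG) :=
  have := nontrivial (K := K) hG
  isSimpleRing_of_exists_mul_mul_eq_one fun _ hp => exists_mul_mul_eq_one H hp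

end NekrashevychAlgebra

namespace Basilica

/-- The generator `a` as an element of the Basilica group. -/
def genA : group := ⟨a, Subgroup.subset_closure (by simp)⟩

/-- The generator `c` as an element of the Basilica group. -/
def genC : group := ⟨c, Subgroup.subset_closure (by simp)⟩

@[simp]
theorem letter_sec_genA_zero : isSelfSimilar.letter genA 0 = 0 ∧ isSelfSimilar.sec genA 0 = 1 :=
  isSelfSimilar.eq_of_apply_cons fun w => by simp [genA, a, aFun]

@[simp]
theorem letter_sec_genA_one : isSelfSimilar.letter genA 1 = 1 ∧ isSelfSimilar.sec genA 1 = genC :=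
  isSelfSimilar.eq_of_apply_cons fun w => by simp [genA, genC, a, c, aFun]

@[simp]
theorem letter_sec_genC_zero : isSelfSimilar.letter genC 0 = 1 ∧ isSelfSimilar.sec genC 0 = 1 :=
  isSelfSimilar.eq_of_apply_cons fun w => by simp [genC, c, cFun]

@[simp]
theorem letter_sec_genC_one : isSelfSimilar.letter genC 1 = 0 ∧ isSelfSimilar.sec genC 1 = genA :=
  isSelfSimilar.eq_of_apply_cons fun w => by simp [genA, genC, a, c, cFun]

@[simp]
theorem letter_sec_genA_inv_zero :
    isSelfSimilar.letter genA⁻¹ 0 = 0 ∧ isSelfSimilar.sec genA⁻¹ 0 = 1 := by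
  simpa only [inv_one] using IsSelfSimilar.letter_sec_inv letter_sec_genA_zero

@[simp]
theorem letter_sec_genA_inv_one :
    isSelfSimilar.letter genA⁻¹ 1 = 1 ∧ isSelfSimilar.sec genA⁻¹ 1 = genC⁻¹ :=
  IsSelfSimilar.letter_sec_inv letter_sec_genA_one

@[simp]
theorem letter_sec_genC_inv_zero :
    isSelfSimilar.letter genC⁻¹ 0 = 1 ∧ isSelfSimilar.sec genC⁻¹ 0 = genA⁻¹ :=
  IsSelfSimilar.letter_sec_inv letter_sec_genC_one

@[simp]
theorem letter_sec_genC_inv_one :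
    isSelfSimilar.letter genC⁻¹ 1 = 0 ∧ isSelfSimilar.sec genC⁻¹ 1 = 1 := by
  simpa only [inv_one] using IsSelfSimilar.letter_sec_inv letter_sec_genC_zero

/-- The generators of the Basilica group, their inverses, and the identity: a generating set that is
closed under taking inverses and sections. -/
def generators : Set group := {1, genA, genA⁻¹, genC, genC⁻¹}

/-- The nucleus of the Basilica group. -/
def nucleus : Set group := {1, genA, genA⁻¹, genC, genC⁻¹, genA * genC⁻¹, genC * genA⁻¹}

theorem closure_generators : Subgroup.closure generators = ⊤ := by
  have genA_mem : genA ∈ generators := by simp [generators]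
  have genC_mem : genC ∈ generators := by simp [generators]
  refine top_le_iff.mp (Subgroup.closure_closure_coe_preimage.ge.trans (Subgroup.closure_mono ?_))
  rintro g (hg | hg)
  · exact (Subtype.ext hg : g = genA) ▸ genA_mem
  · exact (Subtype.ext hg : g = genC) ▸ genC_mem

theorem inv_mem_generators : ∀ s ∈ generators, s⁻¹ ∈ generators := by
  simp [generators]

theorem sec_mem_generators : ∀ s ∈ generators, ∀ x, isSelfSimilar.sec s x ∈ generators := by
  simp [generators, Fin.forall_fin_two]

theorem secWord_mul_mem_nucleus : ∀ s ∈ generators, ∀ h ∈ nucleus, ∀ u : List (Fin 2),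
    u.length = 2 → isSelfSimilar.secWord (s * h) u ∈ nucleus := by
  intro s hs h hh u hu
  obtain ⟨x, y, rfl⟩ := List.length_eq_two.mp hu
  revert x y s h
  simp [generators, nucleus, Fin.forall_fin_two, IsSelfSimilar.letter_mul, IsSelfSimilar.sec_mul]

theorem contractsInto_nucleus : isSelfSimilar.ContractsInto nucleus :=
  IsSelfSimilar.contractsInto_of_closure_eq_top closure_generators inv_mem_generators
    sec_mem_generators (Set.mem_insert 1 _) secWord_mul_mem_nucleus

theorem secWord_eq_one_of_mem_nucleus : ∀ h ∈ nucleus, ∀ u : List (Fin 2), u.length = 2 →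
    h.1 u = u → isSelfSimilar.secWord h u = 1 := by
  intro h hh u hu
  obtain ⟨x, y, rfl⟩ := List.length_eq_two.mp hu
  rw [isSelfSimilar.apply_cons, isSelfSimilar.apply_cons, isSelfSimilar.apply_nil]
  revert x y h
  simp [nucleus, Fin.forall_fin_two, IsSelfSimilar.letter_mul, IsSelfSimilar.sec_mul]

theorem isRegular : isSelfSimilar.IsRegular :=
  contractsInto_nucleus.isRegular secWord_eq_one_of_mem_nucleus

end Basilica

/-- The Basilica group has a simple Nekrashevych algebra over every field. -/
theorem mainTheorem12 (K : Type*) [Field K] :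
    IsSimpleRing (NekrashevychAlgebra K Basilica.isSelfSimilar) :=
  NekrashevychAlgebra.isSimpleRing_of_isRegular Basilica.isRegular
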